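/- Let $G=(V,E)$ be a finite planar graph (loops and multiple edges allowed, not necessarily connected) drawn in the plane, and let $G^*=(V^*,E^*)$ be its planar dual: $V^*$ is the set of faces, and the dual $e^*=\langle i^*j^*\rangle$ of an edge $e=\langle ij\rangle\in E$ joins the faces on the two sides of $e$. For weights $(w_0,w_1,w_2,w_3)$, let $$Z_{\rm mAT}(G,G^*;w_0,w_1,w_2,w_3)=\sum_{\sigma\in\{\pm1\}^{V}}\ \sum_{\tau\in\{\pm1\}^{V^*}}\ \prod_{e=\langle ij\rangle\in E} w(\sigma_i\sigma_j,\tau_{i^*}\tau_{j^*}),$$ where $w(1,1)=w_0$, $w(1,-1)=w_1$, $w(-1,1)=w_2$, $w(-1,-1)=w_3$. The mixed Ashkin–Teller (mAT) model with real couplings $\widehat K_2,\widehat K'_2,\widehat K_4$ and energy constant $\widehat K_0$ (usually $\widehat K_0=0$) has Hamiltonian $$\mathcal H_{\rm mAT}=-\sum_{e=\langle ij\rangle\in E}\left[\widehat K_0+\widehat K_2\,\sigma_i\sigma_j+\widehat K'_2\,\tau_{i^*}\tau_{j^*}+\widehat K_4\,\sigma_i\sigma_j\tau_{i^*}\tau_{j^*}\right]$$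 and partition function $\sum_{\sigma,\tau}e^{-\mathcal H_{\rm mAT}}$; its edge weights are $\widehat\omega(s,t)=e^{\widehat K_0+\widehat K_2 s+\widehat K'_2 t+\widehat K_4 st}$, with $\widehat\omega_0=\widehat\omega(1,1)$, $\widehat\omega_1=\widehat\omega(1,-1)$, $\widehat\omega_2=\widehat\omega(-1,1)$, $\widehat\omega_3=\widehat\omega(-1,-1)$. The infinite-coupling-limit Ashkin–Teller (ICLAT) model on $G$ with real couplings $L_2,L'_2$ has the normalized partition function $$Z_{\rm ICLAT}(G;L_2,L'_2)=\lim_{L\to-\infty}\ \sum_{\sigma,\tau\in\{\pm1\}^{V}}\ \prod_{\langle ij\rangle\in E}\frac{e^{(L_2-L)\sigma_i\sigma_j+(L'_2-L)\tau_i\tau_j+L\,\sigma_i\sigma_j\tau_i\tau_j}}{e^{L_2+L'_2-L}} .$$ **Theorem.** Suppose $\widehat K'_2=\widehat K_4>0$. Then there are unique real $L_2,L'_2$ with $$e^{-2L'_2}=\tanh(2\widehat K'_2),\qquad e^{-2L_2}=\frac{e^{-2\widehat K_2}}{\cosh(2\widehat K'_2)}.$$ They also satisfy $e^{-2L'_2}=\dfrac{\widehat\omega_0-\widehat\omega_1}{\widehat\omega_0+\widehat\omega_1}$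 and $e^{-2L_2}=\dfrac{2\widehat\omega_2}{\widehat\omega_0+\widehat\omega_1}$. The limit defining $Z_{\rm ICLAT}(G;L_2,L'_2)$ exists, the partition function of the mAT model on $G$ and $G^*$ with these couplings equals $Z_{\rm mAT}(G,G^*;\widehat\omega_0,\widehat\omega_1,\widehat\omega_2,\widehat\omega_2)$, and $$Z_{\rm mAT}(G,G^*;\widehat\omega_0,\widehat\omega_1,\widehat\omega_2,\widehat\omega_2)=2^{-|V|+1}\left[\prod_{\langle ij\rangle\in E}\omega_0\right]Z_{\rm ICLAT}(G;L_2,L'_2),\qquad \omega_0=\widehat\omega_0+\widehat\omega_1 .$$ -/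

import Mathlib

open Filter Topology

/-- A multigraph with vertex set `V` and edge set `E`: every edge has an unordered pair of ends.
Loops and parallel edges are allowed (duals have them even when the primal graph does not); a
simple graph is the special case in which `ends` is the inclusion of its edge set. -/
structure Multigraph (V E : Type*) where
  ends : E → Sym2 V

namespace Multigraph

/-- The simple graph of adjacency (loops dropped, parallel edges merged). It has the same
connected components as the multigraph. -/
def adjGraph {V E : Type*} (G : Multigraph V E) : SimpleGraph V :=
  SimpleGraph.fromEdgeSet (Set.range G.ends)

/-- The number of connected components; an isolated vertex is a component. -/
noncomputable def numComponents {V E : Type*} (G : Multigraph V E) : ℕ :=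
  Nat.card G.adjGraph.ConnectedComponent

/-- The product `s_i s_j` of the Ising spins at the two ends of the edge `e = ⟨ij⟩`; a spin is a
unit of `ℤ`, that is, `+1` or `-1`. -/
def bond {V E : Type*} (G : Multigraph V E) (s : V → ℤˣ) (e : E) : ℝ :=
  ((((G.ends e).map s).mul : ℤˣ) : ℤ)

end Multigraph

/-- The two orientations of an edge are the darts `(e, false)` and `(e, true)`; this map reverses
a dart. -/
def revDart {E : Type*} (d : E × Bool) : E × Bool := (d.1, !d.2)

/-- The local combinatorial data of a drawing of `G` on an oriented surface, with set of
faces `F`. -/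
structure SurfaceDrawing {V E : Type*} (G : Multigraph V E) (F : Type*) where
  /-- the vertex at which a dart starts -/
  origin : E × Bool → V
  /-- the face on the left of a dart -/
  leftFace : E × Bool → F
  /-- the next dart in counterclockwise order around the starting vertex -/
  rot : Equiv.Perm (E × Bool)
  /-- the darts of an edge start at its ends -/
  ends_eq : ∀ e, G.ends e = s(origin (e, false), origin (e, true))
  /-- `rot` permutes the darts that start at a given vertex cyclically -/
  sameCycle_iff : ∀ d d', rot.SameCycle d d' ↔ origin d = origin d'
  /-- the sector between a dart `d` and the next dart `rot d` is on the left of `d` and on the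
  right of `rot d` -/
  leftFace_sector : ∀ d, leftFace (revDart (rot d)) = leftFace d

/-- The dual multigraph: its vertices are the faces, its edges correspond to the edges of `G`, and
the dual of an edge joins the faces on the two sides of that edge. -/
def SurfaceDrawing.dual {V E F : Type*} {G : Multigraph V E} (D : SurfaceDrawing G F) :
    Multigraph F E where
  ends e := s(D.leftFace (e, false), D.leftFace (e, true))

/-- A drawing of a finite multigraph `G`, connected or not, in the plane (equivalently, on the
sphere) with set of faces `F`, in combinatorial form.

In a drawing in the plane one can walk from any face to any other one across edges, and Euler's
formula `|V| - |E| + |F| = 1 + c` holds, `c` being the number of components. Conversely, let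
`f_i` be the number of boundary walks (cycles of the face permutation, or one for an isolated
vertex) of the `i`-th component and `g_i` its genus, so `|V| - |E| + ∑ f_i = 2c - 2 ∑ g_i`. Each
boundary walk lies in one face, and a face may be bounded by walks of several components. The
bipartite incidence multigraph of components and faces has `c + |F|` nodes and `∑ f_i` links, and
it is connected since the dual is; hence `c + |F| ≤ ∑ f_i + 1`. With Euler's formula this
gives `g_i = 0` for all `i`, and that the incidence multigraph is a tree: the drawing is obtained
from spherical drawings of the components by gluing spheres in a tree-like way, so it is a drawing
on the sphere. For a connected `G` this is a combinatorial map of genus zero, with faces the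
cycles of the face permutation. -/
structure PlaneDrawing {V E : Type*} [Fintype V] [Fintype E] (G : Multigraph V E)
    (F : Type*) [Fintype F] extends SurfaceDrawing G F where
  dual_connected : toSurfaceDrawing.dual.adjGraph.Connected
  euler : Fintype.card V + Fintype.card F = Fintype.card E + 1 + G.numComponents

noncomputable section

/-- The Boltzmann weight of an edge of an Ashkin--Teller model as a function of `s = σ_i σ_j` and
`t = τ_i τ_j`. The constant `K0` fixes the zero of energy. -/
def edgeWeight (K0 K2 K2' K4 s t : ℝ) : ℝ :=
  Real.exp (K0 + K2 * s + K2' * t + K4 * s * t)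

/-- The Hamiltonian of the mixed Ashkin--Teller model on a pair `G`, `H` of multigraphs with the
same edge set (the edge `e` of `H` being the dual of the edge `e` of `G`): the spins `σ` live on
the vertices of `G`, the spins `τ` on those of `H`. -/
def mixedATHamiltonian {V E F : Type*} [Fintype E] (G : Multigraph V E) (H : Multigraph F E)
    (K0 K2 K2' K4 : ℝ) (σ : V → ℤˣ) (τ : F → ℤˣ) : ℝ :=
  - K0 * Fintype.card E - K2 * ∑ e, G.bond σ e - K2' * ∑ e, H.bond τ e
    - K4 * ∑ e, G.bond σ e * H.bond τ e

/-- The partition function of the mixed Ashkin--Teller model, in terms of its couplings. -/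
def mixedATPartition {V E F : Type*} [Fintype V] [DecidableEq V] [Fintype E] [Fintype F]
    [DecidableEq F] (G : Multigraph V E) (H : Multigraph F E) (K0 K2 K2' K4 : ℝ) : ℝ :=
  ∑ σ : V → ℤˣ, ∑ τ : F → ℤˣ, Real.exp (- mixedATHamiltonian G H K0 K2 K2' K4 σ τ)

/-- The weight selected by `s = σ_i σ_j` and `t = τ_i τ_j` among `w0` (for `s = t = 1`),
`w1` (for `s = 1`, `t = -1`), `w2` (for `s = -1`, `t = 1`) and `w3` (for `s = t = -1`). -/
def selectWeight (w0 w1 w2 w3 s t : ℝ) : ℝ :=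
  if s = 1 then (if t = 1 then w0 else w1) else (if t = 1 then w2 else w3)

/-- The partition function of the mixed Ashkin--Teller model, in terms of its four edge
weights. -/
def mixedATPartitionOfWeights {V E F : Type*} [Fintype V] [DecidableEq V] [Fintype E]
    [Fintype F] [DecidableEq F] (G : Multigraph V E) (H : Multigraph F E)
    (w0 w1 w2 w3 : ℝ) : ℝ :=
  ∑ σ : V → ℤˣ, ∑ τ : F → ℤˣ, ∏ e, selectWeight w0 w1 w2 w3 (G.bond σ e) (H.bond τ e)

/-- The Hamiltonian of the infinite-coupling-limit Ashkin--Teller model before the limit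
`L → -∞` is taken. Both kinds of spins live on the vertices of `G`. -/
def iclatHamiltonian {V E : Type*} [Fintype E] (G : Multigraph V E) (L2 L2' L : ℝ)
    (σ τ : V → ℤˣ) : ℝ :=
  - ∑ e, ((L2 - L) * G.bond σ e + (L2' - L) * G.bond τ e + L * (G.bond σ e * G.bond τ e))

/-- The partition function before the limit, with the edge weights normalized so that the
weight `exp (L2 + L2' - L)` of the configuration `σ_i σ_j = τ_i τ_j = 1` becomes `1`. -/
def iclatPrelimit {V E : Type*} [Fintype V] [DecidableEq V] [Fintype E] (G : Multigraph V E)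
    (L2 L2' L : ℝ) : ℝ :=
  (∑ σ : V → ℤˣ, ∑ τ : V → ℤˣ, Real.exp (- iclatHamiltonian G L2 L2' L σ τ)) /
    ∏ _e : E, edgeWeight 0 (L2 - L) (L2' - L) L 1 1

/-- The partition function of the infinite-coupling-limit Ashkin--Teller model: the limit of the
normalized partition function as `L → -∞`. -/
def iclatPartition {V E : Type*} [Fintype V] [DecidableEq V] [Fintype E] (G : Multigraph V E)
    (L2 L2' : ℝ) : ℝ :=
  limUnder atBot (iclatPrelimit G L2 L2')

end

/-! The spins `σ` are held fixed and only the face spins `τ` are dualized. Since each `τ`-bond is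
`±1`, every edge weight is affine in it, with mean `p e` and slope `q e`. Poisson summation over
`ZMod 2` turns the sum over `τ` into a sum over the left kernel of the dual incidence matrix, that
is, over even edge sets of the dual (`sum_prod_affine_spinChar`). In the plane these are exactly the
cuts of `G` (`PlaneDrawing.ker_boundary_dual_eq_range`), and each cut comes from `2 ^ c` spin
configurations on `V`, where `c` is the number of components (`sum_comp_linearMap`).

Equality of the last two mAT weights means zero slope wherever the `σ`-bond is `-1`. After duality
this becomes a vanishing weight for two negative bonds, which is what the limit `L → -∞` produces
(`tendsto_iclatPrelimit`). -/

/-! ### Spins and characters of `ZMod 2` -/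

/-- The isomorphism from the additive group `ZMod 2` to the group of spins. -/
def spinEquiv : ZMod 2 ≃ ℤˣ where
  toFun x := if x = 0 then 1 else -1
  invFun u := if u = 1 then 0 else 1
  left_inv := by decide
  right_inv := by decide

theorem spinEquiv_add : ∀ x y : ZMod 2, spinEquiv (x + y) = spinEquiv x * spinEquiv y := by
  decide

/-- The nontrivial real character of `ZMod 2`. -/
noncomputable def spinChar (x : ZMod 2) : ℝ := ((spinEquiv x : ℤˣ) : ℤ)

theorem spinChar_zero : spinChar 0 = 1 := by simp [spinChar, spinEquiv]

theorem spinChar_one : spinChar 1 = -1 := by simp [spinChar, spinEquiv]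

theorem spinChar_add (x y : ZMod 2) : spinChar (x + y) = spinChar x * spinChar y := by
  simp [spinChar, spinEquiv_add]

theorem zmod_two_eq_zero_or_one : ∀ x : ZMod 2, x = 0 ∨ x = 1 := by decide

theorem spinChar_eq_one_iff (x : ZMod 2) : spinChar x = 1 ↔ x = 0 := by
  rcases zmod_two_eq_zero_or_one x with rfl | rfl
  · simp [spinChar_zero]
  · rw [spinChar_one]
    norm_num

theorem spinChar_sum {ι : Type*} (s : Finset ι) (f : ι → ZMod 2) :
    spinChar (∑ i ∈ s, f i) = ∏ i ∈ s, spinChar (f i) := by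
  classical
  induction s using Finset.induction_on with
  | empty => simp [spinChar_zero]
  | insert i s hi ih => rw [Finset.sum_insert hi, Finset.prod_insert hi, spinChar_add, ih]

theorem sum_zmod_two {M : Type*} [AddCommMonoid M] (f : ZMod 2 → M) :
    ∑ x, f x = f 0 + f 1 := Fin.sum_univ_two f

theorem sum_spinChar_mul (z : ZMod 2) :
    ∑ y, spinChar (z * y) = if z = 0 then 2 else 0 := by
  rw [sum_zmod_two, mul_zero, mul_one, spinChar_zero]
  rcases zmod_two_eq_zero_or_one z with rfl | rfl
  · rw [spinChar_zero, if_pos rfl]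
    norm_num
  · rw [spinChar_one, if_neg one_ne_zero]
    norm_num

theorem sum_spin_config {V : Type*} [Fintype V] [DecidableEq V] (f : (V → ℤˣ) → ℝ) :
    ∑ σ, f σ = ∑ y : V → ZMod 2, f (fun v => spinEquiv (y v)) :=
  (Equiv.sum_comp (Equiv.piCongrRight fun _ : V => spinEquiv) f).symm

/-! ### Incidence matrices and connected components -/

/-- The incidence matrix modulo `2` of the multigraph whose edge `e` has ends `a e` and `b e`. -/
def incidence {V E : Type*} [DecidableEq V] (a b : E → V) : Matrix E V (ZMod 2) :=
  fun e v => (if a e = v then 1 else 0) + (if b e = v then 1 else 0)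

theorem incidence_mulVec {V E : Type*} [Fintype V] [DecidableEq V] (a b : E → V)
    (y : V → ZMod 2) (e : E) : (incidence a b).mulVec y e = y (a e) + y (b e) := by
  simp [incidence, Matrix.mulVec, dotProduct, add_mul, Finset.sum_add_distrib]

theorem Multigraph.bond_spinEquiv {V E : Type*} [Fintype V] [DecidableEq V] (G : Multigraph V E)
    (a b : E → V) (h : ∀ e, G.ends e = s(a e, b e)) (y : V → ZMod 2) (e : E) :
    G.bond (fun v => spinEquiv (y v)) e = spinChar ((incidence a b).mulVec y e) := by
  simp [Multigraph.bond, h, incidence_mulVec, spinChar, spinEquiv_add]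

/-- Modulo 2, `y (a e) + y (b e) = 0` says that the ends of `e` carry equal values. A loop gives a
zero row, so nothing is lost in `adjGraph`. -/
theorem mem_ker_incidence_iff {V E : Type*} [Fintype V] [DecidableEq V] (G : Multigraph V E)
    (a b : E → V) (h : ∀ e, G.ends e = s(a e, b e)) (y : V → ZMod 2) :
    y ∈ LinearMap.ker (incidence a b).mulVecLin ↔
      ∀ v w, G.adjGraph.Reachable v w → y v = y w := by
  have key : y ∈ LinearMap.ker (incidence a b).mulVecLin ↔ ∀ e, y (a e) = y (b e) := by
    rw [LinearMap.mem_ker, Matrix.mulVecLin_apply, funext_iff]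
    refine forall_congr' fun e => ?_
    rw [incidence_mulVec, Pi.zero_apply, CharTwo.add_eq_zero]
  rw [key]
  constructor
  · rintro hy v w ⟨p⟩
    induction p with
    | nil => rfl
    | cons hadj _ ih =>
      refine Eq.trans ?_ ih
      rw [Multigraph.adjGraph, SimpleGraph.fromEdgeSet_adj] at hadj
      obtain ⟨⟨e, he⟩, -⟩ := hadj
      rw [h e, Sym2.eq_iff] at he
      rcases he with ⟨rfl, rfl⟩ | ⟨rfl, rfl⟩
      · exact hy e
      · exact (hy e).symm
  · intro hy e
    by_cases hab : a e = b e
    · rw [hab]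
    · refine hy _ _ (SimpleGraph.Adj.reachable ?_)
      rw [Multigraph.adjGraph, SimpleGraph.fromEdgeSet_adj]
      exact ⟨⟨e, h e⟩, hab⟩

/-- The kernel of the incidence matrix consists of the functions that are constant on each
connected component. -/
noncomputable def kerIncidenceEquiv {V E : Type*} [Fintype V] [DecidableEq V]
    (G : Multigraph V E) (a b : E → V) (h : ∀ e, G.ends e = s(a e, b e)) :
    (G.adjGraph.ConnectedComponent → ZMod 2) ≃ₗ[ZMod 2]
      LinearMap.ker (incidence a b).mulVecLin where
  toFun c := ⟨fun v => c (G.adjGraph.connectedComponentMk v),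
    (mem_ker_incidence_iff G a b h _).2 fun _ _ hvw =>
      congrArg c (SimpleGraph.ConnectedComponent.sound hvw)⟩
  map_add' _ _ := rfl
  map_smul' _ _ := rfl
  invFun y := fun c => SimpleGraph.ConnectedComponent.lift y.1 (fun v w p _ =>
    (mem_ker_incidence_iff G a b h y.1).1 y.2 v w ⟨p⟩) c
  left_inv c := by
    funext x
    induction x using SimpleGraph.ConnectedComponent.ind with
    | h v => rfl
  right_inv y := rfl

theorem finrank_ker_incidence {V E : Type*} [Fintype V] [DecidableEq V]
    (G : Multigraph V E) (a b : E → V) (h : ∀ e, G.ends e = s(a e, b e)) :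
    Module.finrank (ZMod 2) (LinearMap.ker (incidence a b).mulVecLin) = G.numComponents := by
  classical
  have : Fintype G.adjGraph.ConnectedComponent := Fintype.ofFinite _
  rw [← (kerIncidenceEquiv G a b h).finrank_eq, Module.finrank_fintype_fun_eq_card,
    Multigraph.numComponents, Nat.card_eq_fintype_card]

/-! ### Poisson summation and fibres of linear maps -/

/-- The sum over all configurations `y` of the character of `x ⬝ M y` detects the left kernel. -/
theorem sum_prod_spinChar {E F : Type*} [Fintype E] [Fintype F] [DecidableEq F]
    (M : Matrix E F (ZMod 2)) (x : E → ZMod 2) :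
    ∑ y : F → ZMod 2, ∏ e, spinChar (x e * M.mulVec y e) =
      if M.transpose.mulVec x = 0 then (2 : ℝ) ^ Fintype.card F else 0 := by
  have h1 : ∀ y : F → ZMod 2, ∏ e, spinChar (x e * M.mulVec y e) =
      ∏ f, spinChar (M.transpose.mulVec x f * y f) := by
    intro y
    rw [← spinChar_sum, ← spinChar_sum]
    congr 1
    -- Moving `M` to the other side of the pairing makes the sum over `y` factor over `f`.
    have := Matrix.dotProduct_mulVec x M y
    rw [← Matrix.mulVec_transpose] at this
    exact this
  rw [Finset.sum_congr rfl fun y _ => h1 y,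
    ← Fintype.prod_sum (fun f t => spinChar (M.transpose.mulVec x f * t)),
    Finset.prod_congr rfl fun f _ => sum_spinChar_mul _]
  split_ifs with hx
  · simp [hx]
  · obtain ⟨f, hf⟩ := Function.ne_iff.1 hx
    exact Finset.prod_eq_zero (Finset.mem_univ f) (if_neg hf)

/-- Poisson summation over `ZMod 2` for a product of edge weights. -/
theorem sum_prod_affine_spinChar {E F : Type*} [Fintype E] [DecidableEq E] [Fintype F]
    [DecidableEq F] (M : Matrix E F (ZMod 2)) (p q : E → ℝ) :
    ∑ y : F → ZMod 2, ∏ e, (p e + q e * spinChar (M.mulVec y e)) =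
      2 ^ Fintype.card F * ∑ x : E → ZMod 2,
        if M.transpose.mulVec x = 0 then ∏ e, (if x e = 0 then p e else q e) else 0 := by
  have h1 : ∀ y : F → ZMod 2, ∏ e, (p e + q e * spinChar (M.mulVec y e)) =
      ∑ x : E → ZMod 2, (∏ e, (if x e = 0 then p e else q e)) *
        ∏ e, spinChar (x e * M.mulVec y e) := by
    intro y
    simp_rw [← Finset.prod_mul_distrib]
    -- Expanding the product: `x e` records whether the term `p e` or the character term is taken
    -- from the factor at `e`.
    rw [← Fintype.prod_sum
      (fun e t => (if t = 0 then p e else q e) * spinChar (t * M.mulVec y e))]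
    refine Finset.prod_congr rfl fun e _ => ?_
    rw [sum_zmod_two]
    simp [spinChar_zero]
  simp_rw [h1]
  rw [Finset.sum_comm, Finset.mul_sum]
  refine Finset.sum_congr rfl fun x _ => ?_
  rw [← Finset.mul_sum, sum_prod_spinChar]
  split_ifs <;> ring

/-- Every nonempty fibre of `T` is a coset of its kernel. The predicate `P` allows the range to be
described differently, as the kernel of another map. -/
theorem sum_comp_linearMap {U W : Type*} [AddCommGroup U] [Module (ZMod 2) U] [Fintype U]
    [AddCommGroup W] [Module (ZMod 2) W] [Fintype W] (T : U →ₗ[ZMod 2] W) (P : W → Prop)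
    [DecidablePred P] (hP : ∀ x, P x ↔ x ∈ LinearMap.range T) (g : W → ℝ) :
    ∑ y, g (T y) = 2 ^ Module.finrank (ZMod 2) (LinearMap.ker T) *
      ∑ x, if P x then g x else 0 := by
  classical
  have hcard : ∀ x, ∑ y with T y = x, g (T y) =
      2 ^ Module.finrank (ZMod 2) (LinearMap.ker T) * if P x then g x else 0 := by
    intro x
    split_ifs with hx
    · obtain ⟨y0, rfl⟩ := (hP x).1 hx
      rw [Finset.sum_congr rfl (g := fun _ => g (T y0))
        (fun y hy => by rw [(Finset.mem_filter.1 hy).2]), Finset.sum_const, nsmul_eq_mul]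
      congr 1
      have hc : Fintype.card (LinearMap.ker T) =
          2 ^ Module.finrank (ZMod 2) (LinearMap.ker T) := by
        simpa using Module.card_eq_pow_finrank (K := ZMod 2) (V := LinearMap.ker T)
      have : (Finset.univ.filter fun y => T y = T y0).card = Fintype.card (LinearMap.ker T) := by
        rw [← Fintype.card_subtype]
        refine Fintype.card_congr ⟨fun y => ⟨y.1 - y0, ?_⟩, fun k => ⟨k.1 + y0, ?_⟩, ?_, ?_⟩
        · simp [LinearMap.mem_ker, y.2]
        · simp [LinearMap.mem_ker.1 k.2]
        · intro y; simp
        · intro k; simp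
      rw [this, hc]; norm_num
    · rw [mul_zero]
      refine Finset.sum_eq_zero fun y hy => (hx ?_).elim
      rw [hP]
      exact ⟨y, (Finset.mem_filter.1 hy).2⟩
  rw [Finset.mul_sum, ← Finset.sum_congr rfl fun x _ => hcard x]
  exact (Finset.sum_fiberwise _ _ _).symm

/-! ### Cuts of the graph and even subgraphs of the dual -/

namespace SurfaceDrawing

/-- Every cut of a graph drawn on a surface is crossed an even number of times by the boundary
of each face. -/
theorem incidence_dual_mul {V E F : Type*} [Fintype V] [DecidableEq V] [Fintype E]
    [DecidableEq F] {G : Multigraph V E} (D : SurfaceDrawing G F) (y : V → ZMod 2) :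
    (incidence (fun e => D.leftFace (e, false)) (fun e => D.leftFace (e, true))).transpose.mulVec
      ((incidence (fun e => D.origin (e, false)) (fun e => D.origin (e, true))).mulVec y) = 0 := by
  classical
  funext f
  let χ : E × Bool → ZMod 2 := fun d => if D.leftFace d = f then 1 else 0
  let rev : Equiv.Perm (E × Bool) :=
    ⟨revDart, revDart, fun d => by simp [revDart], fun d => by simp [revDart]⟩
  have hsum : ∑ d, χ d * y (D.origin (revDart d)) = ∑ d, χ d * y (D.origin d) := by
    -- Turning to the next dart at a vertex and reversing it keeps the left face, while the new end
    -- point is the old origin: a step along the boundary of the face.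
    rw [← Equiv.sum_comp (D.rot.trans rev)]
    refine Finset.sum_congr rfl fun d _ => ?_
    have h1 : (D.rot.trans rev) d = revDart (D.rot d) := rfl
    have h2 : revDart (revDart (D.rot d)) = D.rot d := by simp [revDart]
    have h3 : D.origin (D.rot d) = D.origin d :=
      ((D.sameCycle_iff d (D.rot d)).1 ⟨1, by simp⟩).symm
    simp only [h1, h2, h3, χ, D.leftFace_sector]
  -- Grouped by edges, this dart sum is the entry at `f` of the product in the goal.
  have htot : ∑ d, χ d * (y (D.origin d) + y (D.origin (revDart d))) = 0 := by
    simp_rw [mul_add]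
    rw [Finset.sum_add_distrib, hsum, CharTwo.add_self_eq_zero]
  rw [Pi.zero_apply, ← htot, Fintype.sum_prod_type]
  refine Finset.sum_congr rfl fun e _ => ?_
  rw [incidence_mulVec, Fintype.sum_bool]
  simp only [Matrix.transpose_apply, incidence, χ, revDart, Bool.not_true, Bool.not_false]
  ring

end SurfaceDrawing

namespace PlaneDrawing

variable {V E F : Type*} [Fintype V] [DecidableEq V] [Fintype E] [Fintype F] [DecidableEq F]
  {G : Multigraph V E}

/-- For a drawing in the plane the even subgraphs of the dual are the cuts. -/
theorem ker_boundary_dual_eq_range (D : PlaneDrawing G F) :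
    LinearMap.range
      (incidence (fun e => D.origin (e, false)) (fun e => D.origin (e, true))).mulVecLin =
    LinearMap.ker (incidence (fun e => D.leftFace (e, false))
      (fun e => D.leftFace (e, true))).transpose.mulVecLin := by
  classical
  set B := incidence (fun e => D.origin (e, false)) (fun e => D.origin (e, true)) with hB
  set C := incidence (fun e => D.leftFace (e, false)) (fun e => D.leftFace (e, true)) with hC
  refine Submodule.eq_of_le_of_finrank_eq ?_ ?_
  · rintro _ ⟨y, rfl⟩
    exact D.incidence_dual_mul y
  · have h1 := LinearMap.finrank_range_add_finrank_ker B.mulVecLin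
    have h2 := LinearMap.finrank_range_add_finrank_ker C.mulVecLin
    have h3 := LinearMap.finrank_range_add_finrank_ker C.transpose.mulVecLin
    have h4 : Module.finrank (ZMod 2) (LinearMap.range C.transpose.mulVecLin) =
        Module.finrank (ZMod 2) (LinearMap.range C.mulVecLin) := Matrix.rank_transpose C
    rw [hB, finrank_ker_incidence G _ _ D.ends_eq, ← hB] at h1
    rw [hC, finrank_ker_incidence D.dual _ _ fun _ => rfl, ← hC] at h2
    have h5 : D.dual.numComponents = 1 := by
      rw [Multigraph.numComponents, Nat.card_eq_one_iff_unique]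
      exact ⟨D.dual_connected.preconnected.subsingleton_connectedComponent,
        ⟨D.dual.adjGraph.connectedComponentMk D.dual_connected.nonempty.some⟩⟩
    have h6 := D.euler
    simp only [Module.finrank_fintype_fun_eq_card] at h1 h2 h3
    -- The ranks are `|V| - c` for the cuts and `|E| - (|F| - 1)` for the left kernel; Euler's
    -- formula equates them.
    omega

/-- Duality for products of inhomogeneous edge weights. -/
theorem sum_prod_affine_bond_dual (D : PlaneDrawing G F) (p q : E → ℝ) :
    2 ^ G.numComponents * ∑ τ : F → ℤˣ, ∏ e, (p e + q e * D.dual.bond τ e) =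
      2 ^ Fintype.card F *
        ∑ τ : V → ℤˣ, ∏ e, (if G.bond τ e = 1 then p e else q e) := by
  classical
  rw [sum_spin_config, sum_spin_config]
  simp_rw [D.dual.bond_spinEquiv _ _ (fun _ => rfl), G.bond_spinEquiv _ _ D.ends_eq,
    spinChar_eq_one_iff]
  rw [sum_prod_affine_spinChar]
  have := sum_comp_linearMap
    (incidence (fun e => D.origin (e, false)) (fun e => D.origin (e, true))).mulVecLin
    (fun x => (incidence (fun e => D.leftFace (e, false))
      (fun e => D.leftFace (e, true))).transpose.mulVec x = 0)
    (fun x => by rw [D.ker_boundary_dual_eq_range]; rfl)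
    (fun x => ∏ e, (if x e = 0 then p e else q e))
  rw [finrank_ker_incidence G _ _ D.ends_eq] at this
  simp only [Matrix.mulVecLin_apply] at this
  rw [mul_left_comm, ← this]
  congr!

end PlaneDrawing

/-! ### Partition functions, the limit and duality -/

theorem Multigraph.bond_eq_one_or {V E : Type*} (G : Multigraph V E) (s : V → ℤˣ) (e : E) :
    G.bond s e = 1 ∨ G.bond s e = -1 := by
  rcases Int.units_eq_one_or ((G.ends e).map s).mul with h | h <;> simp [Multigraph.bond, h]

theorem mixedATPartition_eq_ofWeights {V E F : Type*} [Fintype V] [DecidableEq V] [Fintype E]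
    [Fintype F] [DecidableEq F] (G : Multigraph V E) (H : Multigraph F E) (K0 K2 K2' K4 : ℝ) :
    mixedATPartition G H K0 K2 K2' K4 =
      mixedATPartitionOfWeights G H (edgeWeight K0 K2 K2' K4 1 1) (edgeWeight K0 K2 K2' K4 1 (-1))
        (edgeWeight K0 K2 K2' K4 (-1) 1) (edgeWeight K0 K2 K2' K4 (-1) (-1)) := by
  refine Finset.sum_congr rfl fun σ _ => Finset.sum_congr rfl fun τ _ => ?_
  have h : -mixedATHamiltonian G H K0 K2 K2' K4 σ τ =
      ∑ e, (K0 + K2 * G.bond σ e + K2' * H.bond τ e + K4 * G.bond σ e * H.bond τ e) := by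
    simp only [mixedATHamiltonian, Finset.sum_add_distrib, Finset.mul_sum, mul_assoc]
    simp
    ring
  rw [h, Real.exp_sum]
  refine Finset.prod_congr rfl fun e _ => ?_
  have h1 : (-1 : ℝ) ≠ 1 := by norm_num
  rcases G.bond_eq_one_or σ e with hs | hs <;> rcases H.bond_eq_one_or τ e with ht | ht <;>
    simp [selectWeight, edgeWeight, hs, ht, h1]

/-- The prelimit partition function of the ICLAT model tends to a sum over configurations in
which the edge weight of `σ_i σ_j = τ_i τ_j = -1` vanishes. -/
theorem tendsto_iclatPrelimit {V E : Type*} [Fintype V] [DecidableEq V] [Fintype E]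
    (G : Multigraph V E) (L2 L2' : ℝ) :
    Tendsto (iclatPrelimit G L2 L2') atBot
      (𝓝 (mixedATPartitionOfWeights G G 1 (Real.exp (-2 * L2')) (Real.exp (-2 * L2)) 0)) := by
  -- After normalization `L` survives only in the weight of two negative bonds, which decays as `L →
  -- -∞`.
  have h : ∀ L, iclatPrelimit G L2 L2' L = mixedATPartitionOfWeights G G 1
      (Real.exp (-2 * L2')) (Real.exp (-2 * L2)) (Real.exp (4 * L + -2 * (L2 + L2'))) := by
    intro L
    simp only [iclatPrelimit, mixedATPartitionOfWeights, Finset.sum_div]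
    refine Finset.sum_congr rfl fun σ _ => Finset.sum_congr rfl fun τ _ => ?_
    rw [iclatHamiltonian, neg_neg, Real.exp_sum, ← Finset.prod_div_distrib]
    refine Finset.prod_congr rfl fun e _ => ?_
    have h1 : (-1 : ℝ) ≠ 1 := by norm_num
    rw [edgeWeight, ← Real.exp_sub]
    rcases G.bond_eq_one_or σ e with hs | hs <;> rcases G.bond_eq_one_or τ e with ht | ht <;>
      simp only [selectWeight, hs, ht, h1, if_true, if_false]
    · rw [← Real.exp_zero]; congr 1; ring
    all_goals congr 1; ring
  rw [funext h]
  refine tendsto_finsetSum _ fun σ _ => tendsto_finsetSum _ fun τ _ =>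
    tendsto_finsetProd _ fun e _ => ?_
  unfold selectWeight
  split_ifs
  · exact tendsto_const_nhds
  · exact tendsto_const_nhds
  · exact tendsto_const_nhds
  · exact Real.tendsto_exp_atBot.comp (tendsto_atBot_add_const_right _ _
      (tendsto_id.const_mul_atBot (by norm_num)))

/-- Duality in the second kind of spins takes a mixed Ashkin--Teller model with `w2 = w3` to an
Ashkin--Teller model in the infinite coupling limit. -/
theorem PlaneDrawing.mixedATPartitionOfWeights_dual {V E F : Type*} [Fintype V] [DecidableEq V]
    [Fintype E] [Fintype F] [DecidableEq F] {G : Multigraph V E} (D : PlaneDrawing G F)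
    (w0 w1 w2 : ℝ) (hw : w0 + w1 ≠ 0) :
    mixedATPartitionOfWeights G D.dual w0 w1 w2 w2 =
      (2 : ℝ) ^ (1 - (Fintype.card V : ℤ)) * (∏ _e : E, (w0 + w1)) *
        mixedATPartitionOfWeights G G 1 ((w0 - w1) / (w0 + w1)) (2 * w2 / (w0 + w1)) 0 := by
  have h1 : (-1 : ℝ) ≠ 1 := by norm_num
  simp only [mixedATPartitionOfWeights, Finset.mul_sum (s := (Finset.univ : Finset (V → ℤˣ)))]
  refine Finset.sum_congr rfl fun σ _ => ?_
  rw [← Finset.mul_sum]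
  have hl : ∀ τ : F → ℤˣ, ∏ e, selectWeight w0 w1 w2 w2 (G.bond σ e) (D.dual.bond τ e) =
      ∏ e, ((if G.bond σ e = 1 then (w0 + w1) / 2 else w2) +
        (if G.bond σ e = 1 then (w0 - w1) / 2 else 0) * D.dual.bond τ e) := by
    refine fun τ => Finset.prod_congr rfl fun e _ => ?_
    rcases D.dual.bond_eq_one_or τ e with ht | ht <;>
      simp only [selectWeight, ht, h1, if_true, if_false] <;> split_ifs <;> ring
  -- Extracting `(w0 + w1) / 2` from every edge normalizes the first dual weight to `1`; the zero
  -- slope gives the last weight `0`.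
  have hr : ∀ τ : V → ℤˣ, ∏ e, (if G.bond τ e = 1 then
        (if G.bond σ e = 1 then (w0 + w1) / 2 else w2) else
        (if G.bond σ e = 1 then (w0 - w1) / 2 else 0)) =
      ((2 ^ Fintype.card E)⁻¹ * ∏ _e : E, (w0 + w1)) * ∏ e, selectWeight 1
        ((w0 - w1) / (w0 + w1)) (2 * w2 / (w0 + w1)) 0 (G.bond σ e) (G.bond τ e) := by
    intro τ
    rw [← inv_pow, ← Finset.card_univ, ← Finset.prod_const, ← Finset.prod_mul_distrib,
      ← Finset.prod_mul_distrib]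
    refine Finset.prod_congr rfl fun e _ => ?_
    unfold selectWeight
    split_ifs <;> field_simp <;> simp
  have key := D.sum_prod_affine_bond_dual
    (fun e => if G.bond σ e = 1 then (w0 + w1) / 2 else w2)
    (fun e => if G.bond σ e = 1 then (w0 - w1) / 2 else 0)
  simp only [← hl, hr] at key
  rw [← Finset.mul_sum] at key
  -- By Euler's formula `|F| - |E| = c + 1 - |V|`; the factor `2 ^ c` cancels against the
  -- multiplicity of cuts.
  have hpow : (2 : ℝ) ^ Fintype.card F * (2 ^ Fintype.card E)⁻¹ =
      2 ^ G.numComponents * 2 ^ (1 - (Fintype.card V : ℤ)) := by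
    have he := D.euler
    simp only [← zpow_natCast, ← zpow_neg]
    rw [← zpow_add₀ two_ne_zero, ← zpow_add₀ two_ne_zero]
    congr 1
    omega
  refine mul_left_cancel₀ (pow_ne_zero G.numComponents (two_ne_zero' ℝ)) (key.trans ?_)
  rw [← mul_assoc, ← mul_assoc, hpow]
  ring

/-! ### Matching the couplings -/

theorem edgeWeight_sum (K0 K2 K : ℝ) :
    edgeWeight K0 K2 K K 1 1 + edgeWeight K0 K2 K K 1 (-1) =
      2 * Real.exp (K0 + K2) * Real.cosh (2 * K) := by
  rw [Real.cosh_eq, edgeWeight, edgeWeight]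
  have e1 : K0 + K2 * 1 + K * 1 + K * 1 * 1 = (K0 + K2) + 2 * K := by ring
  have e2 : K0 + K2 * 1 + K * -1 + K * 1 * -1 = (K0 + K2) + -(2 * K) := by ring
  rw [e1, e2, Real.exp_add (K0 + K2), Real.exp_add (K0 + K2)]
  ring

theorem edgeWeight_sub (K0 K2 K : ℝ) :
    edgeWeight K0 K2 K K 1 1 - edgeWeight K0 K2 K K 1 (-1) =
      2 * Real.exp (K0 + K2) * Real.sinh (2 * K) := by
  rw [Real.sinh_eq, edgeWeight, edgeWeight]
  have e1 : K0 + K2 * 1 + K * 1 + K * 1 * 1 = (K0 + K2) + 2 * K := by ring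
  have e2 : K0 + K2 * 1 + K * -1 + K * 1 * -1 = (K0 + K2) + -(2 * K) := by ring
  rw [e1, e2, Real.exp_add (K0 + K2), Real.exp_add (K0 + K2)]
  ring

theorem existsUnique_exp_neg_two_mul {x y : ℝ} (hx : 0 < x) (hy : 0 < y) :
    ∃! L : ℝ × ℝ, Real.exp (-2 * L.2) = x ∧ Real.exp (-2 * L.1) = y := by
  refine ⟨(-(Real.log y / 2), -(Real.log x / 2)), ⟨?_, ?_⟩, ?_⟩
  · simp only
    rw [show -2 * -(Real.log x / 2) = Real.log x by ring, Real.exp_log hx]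
  · simp only
    rw [show -2 * -(Real.log y / 2) = Real.log y by ring, Real.exp_log hy]
  · rintro ⟨a, b⟩ ⟨rfl, rfl⟩
    simp only [Real.log_exp, Prod.mk.injEq]
    constructor <;> ring

theorem theorem4p4 {V E F : Type*} [Fintype V] [DecidableEq V] [Fintype E]
    [Fintype F] [DecidableEq F] (G : Multigraph V E) (D : PlaneDrawing G F)
    (K0 K2 K2' K4 : ℝ) (hK : K2' = K4) (hpos : 0 < K2')
    (w0 w1 w2 : ℝ)
    (hw0 : w0 = edgeWeight K0 K2 K2' K4 1 1)
    (hw1 : w1 = edgeWeight K0 K2 K2' K4 1 (-1))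
    (hw2 : w2 = edgeWeight K0 K2 K2' K4 (-1) 1) :
    (∃! L : ℝ × ℝ,
        Real.exp (-2 * L.2) = Real.tanh (2 * K2') ∧
        Real.exp (-2 * L.1) = Real.exp (-2 * K2) / Real.cosh (2 * K2')) ∧
    ∀ L2 L2' : ℝ,
      Real.exp (-2 * L2') = Real.tanh (2 * K2') →
      Real.exp (-2 * L2) = Real.exp (-2 * K2) / Real.cosh (2 * K2') →
      Real.exp (-2 * L2') = (w0 - w1) / (w0 + w1) ∧
      Real.exp (-2 * L2) = 2 * w2 / (w0 + w1) ∧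
      Tendsto (iclatPrelimit G L2 L2') atBot (𝓝 (iclatPartition G L2 L2')) ∧
      mixedATPartition G D.dual K0 K2 K2' K4 =
        mixedATPartitionOfWeights G D.dual w0 w1 w2 w2 ∧
      mixedATPartitionOfWeights G D.dual w0 w1 w2 w2 =
        (2 : ℝ) ^ (1 - (Fintype.card V : ℤ)) * (∏ _e : E, (w0 + w1)) *
          iclatPartition G L2 L2' := by
  subst hK
  have hcosh : 0 < Real.cosh (2 * K2') := Real.cosh_pos _
  have hsinh : 0 < Real.sinh (2 * K2') := Real.sinh_pos_iff.2 (by linarith)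
  have hadd : w0 + w1 = 2 * Real.exp (K0 + K2) * Real.cosh (2 * K2') := by
    rw [hw0, hw1, edgeWeight_sum]
  have hsub : w0 - w1 = 2 * Real.exp (K0 + K2) * Real.sinh (2 * K2') := by
    rw [hw0, hw1, edgeWeight_sub]
  have hw2' : w2 = Real.exp (K0 + K2) * Real.exp (-2 * K2) := by
    rw [hw2, edgeWeight, ← Real.exp_add]
    congr 1
    ring
  have hexp := Real.exp_pos (K0 + K2)
  refine ⟨existsUnique_exp_neg_two_mul ?_ (div_pos (Real.exp_pos _) hcosh), ?_⟩
  · rw [Real.tanh_eq_sinh_div_cosh]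
    exact div_pos hsinh hcosh
  intro L2 L2' h' h
  have hL2' : Real.exp (-2 * L2') = (w0 - w1) / (w0 + w1) := by
    rw [h', hadd, hsub, Real.tanh_eq_sinh_div_cosh]
    field_simp
  have hL2 : Real.exp (-2 * L2) = 2 * w2 / (w0 + w1) := by
    rw [h, hadd, hw2']
    field_simp
  have hlim := tendsto_iclatPrelimit G L2 L2'
  have hpart : iclatPartition G L2 L2' =
      mixedATPartitionOfWeights G G 1 (Real.exp (-2 * L2')) (Real.exp (-2 * L2)) 0 :=
    hlim.limUnder_eq
  refine ⟨hL2', hL2, hpart ▸ hlim, ?_, ?_⟩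
  · have hw3 : edgeWeight K0 K2 K2' K2' (-1) (-1) = w2 := by
      rw [hw2, edgeWeight, edgeWeight]
      congr 1
      ring
    rw [mixedATPartition_eq_ofWeights, hw3, ← hw0, ← hw1, ← hw2]
  · rw [hpart, hL2, hL2']
    exact D.mixedATPartitionOfWeights_dual w0 w1 w2 (by rw [hadd]; positivity)
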